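/- Work in max algebra over $\mathbb{R}_+$, with $a\oplus b=\max(a,b)$, $a\otimes b=ab$; $A^k=(a^{(k)}_{ij})$ denotes the max-algebraic power ($A^0=I$) and $A^*=I\oplus A\oplus A^2\oplus\cdots$ the Kleene star. Let $A=(a_{ij})\in\mathbb{R}_+^{n\times n}$ be irreducible (its digraph, with edges $(i,j)$ for $a_{ij}\neq 0$, is strongly connected) and definite, i.e. the maximum $\lambda(A)$ of the geometric means $(a_{i_1i_2}a_{i_2i_3}\cdots a_{i_ki_1})^{1/k}$ over all cycles of the digraph equals $1$. The critical graph $\mathcal{C}(A)$ consists of all nodes and edges on cycles whose geometric mean is $\lambda(A)$. Let $A$ be visualized: $a_{ij}\le 1$ for all $i,j$, and $a_{ij}=1$ for every edge $(i,j)$ of $\mathcal{C}(A)$. Suppose that $\mathcal{C}(A)$ is strongly connected, with node set $\{1,\dots,c\}$ (after renumbering), and let $\overline{c}=n-c$. Let $\gamma$ be the cyclicity of $\mathcal{C}(A)$, the g.c.d. of its cycle lengths, and let $T(A)$ be the transient, the least $T$ such that $A^{r+\gamma}=A^r$ for all $r\ge T$. For $i\le c$ let $[i]$ be the cyclic class of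 $i$, i.e. the set of nodes reachable from $i$ in $\mathcal{C}(A)$ by a path of length $\equiv 0 \pmod\gamma$. Write $[j]\to_m[i]$ if some path of $\mathcal{C}(A)$ from a node of $[j]$ to a node of $[i]$ has length $\equiv m\pmod\gamma$, and let $[\to_m i]$ be the cyclic class $[j]$ with $[j]\to_m[i]$. The core matrix $A^{Core}=(\alpha_{pq})$ is indexed by $\mu$ (the whole critical graph, with node set $N_\mu=\{1,\dots,c\}$) and by $\nu(t)$, $t>c$ (with node set $N_{\nu(t)}=\{t\}$); $\alpha_{pq}$ is the largest $a_{ij}$ with $i\in N_p$, $j\in N_q$, and $\alpha^*_{pq}$ are the entries of $(A^{Core})^*$. For $i\le c$ and $r\ge 0$ let $$K^{(r)}(i)=\{t>c \mid a^{(r)}_{it}=\alpha^*_{\mu\nu(t)}\}.$$ Let $h_{\nu(t)}=\alpha_{\mu\nu(t)}=\max_{1\le k\le c}a_{kt}$ for $t>c$, and let $B=(a_{st})_{s,t>c}$, with powers $B^m=(b^{(m)}_{st})$ and Kleene star $B^*=(b^*_{st})=I\oplus B\oplus\cdots\oplus B^{\overline{c}-1}$. For $s,t>c$ let $$U_{st}=\arg\max_{0\le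 m\le \overline{c}-1} b^{(m)}_{st},\qquad W_t=\arg\max_{s>c}\, h_{\nu(s)}b^*_{st}.$$ For $s>c$, $m\ge 0$ and $i\le c$ put $P_s^{\to m}(i)=1$ if $[\to_{m+1}i]\cap\arg\max_{1\le k\le c}a_{ks}\neq\emptyset$, and $P_s^{\to m}(i)=0$ otherwise. Let $G_t=\bigvee_{s\in W_t}\bigvee_{m\in U_{st}}P_s^{\to m}$ for $t>c$. **Proposition.** Let $t>c$, and let $r\ge T(A)$ be a multiple of $\gamma$. Then for all $i\le c$, $t\in K^{(r)}(i)$ if and only if $G_t(i)=1$. -/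

import Mathlib

open scoped NNReal

noncomputable section

namespace MaxAlg

/-! Max algebra: nonnegative reals with `max` as addition and ordinary multiplication.
In `ℝ≥0` the supremum over the empty set is `0`, the zero of this semiring. -/

variable {V : Type*}

/-- The max-algebraic product `(A ⊗ B) i j = max_k (A i k * B k j)`. -/
def mmul [Fintype V] (A B : Matrix V V ℝ≥0) : Matrix V V ℝ≥0 :=
  fun i j => Finset.univ.sup fun k => A i k * B k j

open Classical in
/-- The max-algebraic power `A ^ k`, with `A ^ 0 = I`. -/
def mpow [Fintype V] (A : Matrix V V ℝ≥0) : ℕ → Matrix V V ℝ≥0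
  | 0 => fun i j => if i = j then 1 else 0
  | k + 1 => mmul (mpow A k) A

/-- The Kleene star `I ⊕ A ⊕ A ^ 2 ⊕ ⋯`: entrywise supremum of all powers
(used only for matrices with entries at most `1`, where this supremum is finite). -/
def kleeneStar [Fintype V] (A : Matrix V V ℝ≥0) : Matrix V V ℝ≥0 :=
  fun i j => ⨆ k : ℕ, mpow A k i j

/-! Paths and cycles. A path of length `k` is recorded by a sequence of which only the nodes
`σ 0, …, σ k` matter. -/

/-- `σ 0, …, σ k` is a path with `k` edges in the digraph with edge relation `E`. -/
def IsPath (E : V → V → Prop) (k : ℕ) (σ : ℕ → V) : Prop :=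
  ∀ l < k, E (σ l) (σ (l + 1))

/-- There is a path with exactly `k` edges from `i` to `j`. -/
def HasPath (E : V → V → Prop) (k : ℕ) (i j : V) : Prop :=
  ∃ σ : ℕ → V, IsPath E k σ ∧ σ 0 = i ∧ σ k = j

/-- `σ 0, …, σ k` is a cycle with `k ≥ 1` edges (not necessarily simple). -/
def IsCycle (E : V → V → Prop) (k : ℕ) (σ : ℕ → V) : Prop :=
  0 < k ∧ IsPath E k σ ∧ σ k = σ 0

/-- Edges of the weighted digraph associated with `A`. -/
def edge (A : Matrix V V ℝ≥0) (i j : V) : Prop := A i j ≠ 0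

/-- The weight of a path: the product of the weights of its edges. -/
def weight (A : Matrix V V ℝ≥0) (k : ℕ) (σ : ℕ → V) : ℝ≥0 :=
  ∏ l ∈ Finset.range k, A (σ l) (σ (l + 1))

/-- The geometric mean of a cycle of length `k`. -/
def cycleMean (A : Matrix V V ℝ≥0) (k : ℕ) (σ : ℕ → V) : ℝ≥0 :=
  weight A k σ ^ ((1 : ℝ) / k)

/-- The maximum cycle geometric mean `λ(A)` (`0` if there are no cycles). -/
def maxCycleMean (A : Matrix V V ℝ≥0) : ℝ≥0 :=
  sSup {x | ∃ k σ, IsCycle (edge A) k σ ∧ x = cycleMean A k σ}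

/-- `A` is irreducible: its digraph is strongly connected. -/
def Irred (A : Matrix V V ℝ≥0) : Prop := ∀ i j, ∃ k, HasPath (edge A) k i j

/-- `A` is definite: `λ(A) = 1`. -/
def Definite (A : Matrix V V ℝ≥0) : Prop := maxCycleMean A = 1

/-- A critical cycle is a cycle whose geometric mean equals `λ(A)`. -/
def IsCritCycle (A : Matrix V V ℝ≥0) (k : ℕ) (σ : ℕ → V) : Prop :=
  IsCycle (edge A) k σ ∧ cycleMean A k σ = maxCycleMean A

/-- Edges of the critical graph: edges that lie on a critical cycle. -/
def critEdge (A : Matrix V V ℝ≥0) (i j : V) : Prop :=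
  ∃ k σ, IsCritCycle A k σ ∧ ∃ l < k, σ l = i ∧ σ (l + 1) = j

/-- Nodes of the critical graph: nodes that lie on a critical cycle. -/
def critNodes (A : Matrix V V ℝ≥0) : Set V :=
  {i | ∃ k σ, IsCritCycle A k σ ∧ ∃ l < k, σ l = i}

/-- A definite matrix is visualized if all entries are at most `1` and the entries on critical
edges equal `1`. -/
structure Visualized (A : Matrix V V ℝ≥0) : Prop where
  definite : Definite A
  le_one : ∀ i j, A i j ≤ 1
  eq_one : ∀ i j, critEdge A i j → A i j = 1

/-- The critical graph is strongly connected. -/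
def CritStronglyConnected (A : Matrix V V ℝ≥0) : Prop :=
  (critNodes A).Nonempty ∧
    ∀ i ∈ critNodes A, ∀ j ∈ critNodes A, ∃ k, HasPath (critEdge A) k i j

/-! From here on the definitions are those for a strongly connected critical graph. -/

/-- The cyclicity `γ` of a strongly connected critical graph: the greatest common divisor of the
lengths of all its cycles. -/
def cyclicity (A : Matrix V V ℝ≥0) : ℕ :=
  Nat.setGcd {k | ∃ σ, IsCycle (critEdge A) k σ}

/-- The transient `T(A)`: the least `T` such that `A ^ (r + γ) = A ^ r` for all `r ≥ T`. -/
def transient [Fintype V] (A : Matrix V V ℝ≥0) : ℕ :=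
  sInf {T | ∀ r ≥ T, mpow A (r + cyclicity A) = mpow A r}

/-- The cyclic class `[i]` of a critical node `i`. -/
def cyclicClass (A : Matrix V V ℝ≥0) (i : V) : Set V :=
  {j | ∃ k, HasPath (critEdge A) k i j ∧ k ≡ 0 [MOD cyclicity A]}

/-- The access relation `[i] →_m [j]`: some critical path from a node of `[i]` to a node of `[j]`
has length congruent to `m` modulo `γ`. -/
def classAccess (A : Matrix V V ℝ≥0) (m : ℕ) (i j : V) : Prop :=
  ∃ i' ∈ cyclicClass A i, ∃ j' ∈ cyclicClass A j, ∃ k,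
    HasPath (critEdge A) k i' j' ∧ k ≡ m [MOD cyclicity A]

/-- `[→_m i]`, the cyclic class from which `[i]` is accessed in `m` steps, as a set of nodes. -/
def classBefore (A : Matrix V V ℝ≥0) (m : ℕ) (i : V) : Set V :=
  {k | k ∈ critNodes A ∧ classAccess A m k i}

/-- The type of non-critical nodes. -/
abbrev NonCrit (A : Matrix V V ℝ≥0) : Type _ := {t : V // t ∉ critNodes A}

instance instFintypeNonCrit [Fintype V] (A : Matrix V V ℝ≥0) : Fintype (NonCrit A) :=
  Fintype.ofFinite _

open Classical in
/-- Node sets of the blocks of the core matrix: `none` stands for the whole critical graph `μ`,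
and `some t` for the non-critical component `ν(t)` that consists of the single node `t`. -/
def block [Fintype V] (A : Matrix V V ℝ≥0) : Option (NonCrit A) → Finset V
  | none => Finset.univ.filter (· ∈ critNodes A)
  | some t => {t.1}

/-- The core matrix: its entries are the maximal entries of the blocks of `A`. -/
def core [Fintype V] (A : Matrix V V ℝ≥0) :
    Matrix (Option (NonCrit A)) (Option (NonCrit A)) ℝ≥0 :=
  fun p q => (block A p).sup fun i => (block A q).sup fun j => A i j

/-- `K^(r)(i)`, for a critical node `i`: the non-critical `t` for which the `(i, t)` entry of
`A ^ r` equals the `(μ, ν(t))` entry of the Kleene star of the core matrix. -/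
def K [Fintype V] (A : Matrix V V ℝ≥0) (r : ℕ) (i : V) : Set (NonCrit A) :=
  {t | mpow A r i t.1 = kleeneStar (core A) none (some t)}

/-- The entries `h_{ν(t)} = max_{k critical} a_{kt}` of the first row of the core matrix. -/
def h [Fintype V] (A : Matrix V V ℝ≥0) (t : NonCrit A) : ℝ≥0 := core A none (some t)

/-- The non-critical principal submatrix `B`. -/
def B (A : Matrix V V ℝ≥0) : Matrix (NonCrit A) (NonCrit A) ℝ≥0 :=
  fun s t => A s.1 t.1

/-- The set of maximizers of `a_{ks}` over critical `k`. -/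
def argmaxCol (A : Matrix V V ℝ≥0) (s : V) : Set V :=
  {k | k ∈ critNodes A ∧ ∀ k' ∈ critNodes A, A k' s ≤ A k s}

open Classical in
/-- `U_{st}`: the arguments of maxima, for the entry `(s, t)`, in the series
`I ⊕ B ⊕ ⋯ ⊕ B ^ (c̄ - 1)` for `B^*`, where `c̄` is the number of non-critical nodes; that is,
the lengths of the paths from `s` to `t` in `B` of maximal weight. -/
def U [Fintype V] (A : Matrix V V ℝ≥0) (s t : NonCrit A) : Finset ℕ :=
  (Finset.range (Fintype.card (NonCrit A))).filter fun m =>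
    ∀ m' < Fintype.card (NonCrit A), mpow (B A) m' s t ≤ mpow (B A) m s t

open Classical in
/-- `W_t`: the maximizers `s` of `h_{ν(s)} * b^*_{ν(s) ν(t)}` over non-critical `s`. -/
def W [Fintype V] (A : Matrix V V ℝ≥0) (t : NonCrit A) : Finset (NonCrit A) :=
  Finset.univ.filter fun s =>
    ∀ s', h A s' * kleeneStar (B A) s' t ≤ h A s * kleeneStar (B A) s t

open Classical in
/-- The shifted Boolean vector `P_s^{→m}`: its entry at a critical node `i` is `1` if and only if
`[→_{m+1} i]` meets the set of maximizers of `a_{ks}` over critical `k`. -/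
def P (A : Matrix V V ℝ≥0) (m : ℕ) (s : NonCrit A) (i : V) : Bool :=
  decide (classBefore A (m + 1) i ∩ argmaxCol A s.1).Nonempty

/-- The Boolean vector `G_t = ⋁_{s ∈ W_t} ⋁_{m ∈ U_{st}} P_s^{→m}` (`⋁` is Boolean `or`). -/
def G [Fintype V] (A : Matrix V V ℝ≥0) (t : NonCrit A) (i : V) : Bool :=
  (W A t).sup fun s => (U A s t).sup fun m => P A m s i

end MaxAlg

end

namespace MaxAlg

/-! ### Max-algebraic powers and walks -/

section General

variable {V : Type*} {A : Matrix V V ℝ≥0}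

/-! Cut an optimal walk of length `r` from the critical node `i` to `t` at its last critical node
`k` (`exists_last_exit`): `p` steps from `i` to `k`, an edge from `k` to a non-critical `s`, then
`m` steps in `B`, with `p + 1 + m = r`. The three weights are at most `1`, `h A s` and the `(s, t)`
entry of the star of `B`. The largest product of the last two over `s` is the core star entry
(`mem_W_iff`), so that entry bounds the walk.

It is nonzero by irreducibility, so equality forces equality in every factor: `s ∈ W A t`, `m ∈ U A
s t`, `k` maximizes its column, and the first piece has weight `1`. By visualization a walk of
weight `1` between critical nodes is a path of the critical graph (`hasPath_of_mpow_eq_one`). Since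
`γ ∣ r`, the length of a critical path from `k` back to `i` is congruent to `m + 1` modulo `γ`,
which is the condition in `P`.

Conversely, these data give optimal walks of every sufficiently large length divisible by `γ`,
because critical paths realise all large lengths in their residue class (`exists_forall_hasPath`).
Ultimate periodicity (`mpow_add_cyclicity`) carries this down to every `r` past the transient. -/

theorem weight_add (A : Matrix V V ℝ≥0) (p q : ℕ) (σ : ℕ → V) :
    weight A (p + q) σ = weight A p σ * weight A q fun l => σ (p + l) := by
  simp only [weight, Finset.prod_range_add, add_assoc]

variable [Fintype V]

theorem mpow_zero_self (A : Matrix V V ℝ≥0) (i : V) : mpow A 0 i i = 1 := by simp [mpow]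

theorem mpow_zero_ne (A : Matrix V V ℝ≥0) {i j : V} (hij : i ≠ j) : mpow A 0 i j = 0 := by
  simp [mpow, hij]

theorem mul_le_mpow_succ (A : Matrix V V ℝ≥0) (m : ℕ) (i k j : V) :
    mpow A m i k * A k j ≤ mpow A (m + 1) i j :=
  Finset.le_sup (f := fun k => mpow A m i k * A k j) (Finset.mem_univ k)

theorem exists_mpow_succ_eq (A : Matrix V V ℝ≥0) (m : ℕ) (i j : V) :
    ∃ k, mpow A (m + 1) i j = mpow A m i k * A k j := by
  obtain ⟨k, -, hk⟩ := Finset.exists_mem_eq_sup (Finset.univ : Finset V) ⟨i, Finset.mem_univ i⟩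
    fun k => mpow A m i k * A k j
  exact ⟨k, hk⟩

theorem le_mpow_one (A : Matrix V V ℝ≥0) (i j : V) : A i j ≤ mpow A 1 i j := by
  simpa [mpow_zero_self] using mul_le_mpow_succ A 0 i i j

theorem mpow_mul_le (A : Matrix V V ℝ≥0) (p q : ℕ) (i k j : V) :
    mpow A p i k * mpow A q k j ≤ mpow A (p + q) i j := by
  induction q generalizing j with
  | zero =>
    by_cases hkj : k = j
    · subst hkj; simp [mpow_zero_self]
    · simp [mpow_zero_ne A hkj]
  | succ q ih =>
    obtain ⟨l, hl⟩ := exists_mpow_succ_eq A q k j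
    rw [hl, ← mul_assoc]
    exact (mul_le_mul_left (ih l) _).trans (mul_le_mpow_succ A (p + q) i l j)

theorem exists_mpow_add_le (A : Matrix V V ℝ≥0) (p q : ℕ) (i j : V) :
    ∃ k, mpow A (p + q) i j ≤ mpow A p i k * mpow A q k j := by
  induction q generalizing j with
  | zero => exact ⟨j, by simp [mpow_zero_self]⟩
  | succ q ih =>
    obtain ⟨l, hl⟩ := exists_mpow_succ_eq A (p + q) i j
    obtain ⟨k, hk⟩ := ih l
    refine ⟨k, ?_⟩
    rw [← add_assoc, hl]
    refine (mul_le_mul_left hk _).trans ?_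
    rw [mul_assoc]
    exact mul_le_mul_right (mul_le_mpow_succ A q k l j) _

theorem mpow_le_one (hA : ∀ i j, A i j ≤ 1) (m : ℕ) (i j : V) : mpow A m i j ≤ 1 := by
  induction m generalizing j with
  | zero => by_cases hij : i = j <;> simp [mpow, hij]
  | succ m ih =>
    obtain ⟨k, hk⟩ := exists_mpow_succ_eq A m i j
    rw [hk]
    exact mul_le_one' (ih k) (hA k j)

theorem weight_le_mpow (A : Matrix V V ℝ≥0) (m : ℕ) (σ : ℕ → V) :
    weight A m σ ≤ mpow A m (σ 0) (σ m) := by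
  induction m with
  | zero => simp [weight, mpow_zero_self]
  | succ m ih =>
    rw [weight, Finset.prod_range_succ]
    exact (mul_le_mul_left ih _).trans (mul_le_mpow_succ A m _ _ _)

theorem exists_weight_eq_mpow {m : ℕ} {i j : V} (hne : mpow A m i j ≠ 0) :
    ∃ σ : ℕ → V, σ 0 = i ∧ σ m = j ∧ weight A m σ = mpow A m i j := by
  classical
  induction m generalizing j with
  | zero =>
    have hij : i = j := by
      by_contra hij
      exact hne (mpow_zero_ne A hij)
    subst hij
    exact ⟨fun _ => i, rfl, rfl, by simp [weight, mpow_zero_self]⟩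
  | succ m ih =>
    obtain ⟨k, hk⟩ := exists_mpow_succ_eq A m i j
    obtain ⟨σ, h0, hm, hw⟩ := ih (j := k) fun h0 => hne (by rw [hk, h0, zero_mul])
    refine ⟨Function.update σ (m + 1) j, by simp [h0], by simp, ?_⟩
    rw [hk, weight, Finset.prod_range_succ, ← hw, weight]
    congr 1
    · refine Finset.prod_congr rfl fun l hl => ?_
      have hl := Finset.mem_range.1 hl
      rw [Function.update_of_ne (by omega), Function.update_of_ne (by omega)]
    · rw [Function.update_self, Function.update_of_ne (by omega), hm]

/-- A walk that is long enough contains a closed walk whose length is a multiple of `g`. -/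
theorem exists_closed_subwalk {g m : ℕ} (hg : 0 < g) (hm : Fintype.card V * g ≤ m) {i j : V}
    (hne : mpow A m i j ≠ 0) :
    ∃ a d b k, a + d + b = m ∧ 0 < d ∧ g ∣ d ∧
      mpow A m i j ≤ mpow A a i k * mpow A d k k * mpow A b k j := by
  obtain ⟨σ, h0, hσm, hw⟩ := exists_weight_eq_mpow hne
  -- Pigeonhole on pairs (node, time modulo `g`): a repeated pair bounds a closed subwalk of length
  -- divisible by `g`.
  have hcard : ((Finset.univ : Finset V) ×ˢ Finset.range g).card < (Finset.range (m + 1)).card := by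
    simp only [Finset.card_product, Finset.card_univ, Finset.card_range]; omega
  obtain ⟨a, ha, b, hb, hab, hf⟩ := Finset.exists_ne_map_eq_of_card_lt_of_maps_to hcard
    (f := fun l => (σ l, l % g)) fun l _ => by simp [Nat.mod_lt _ hg]
  wlog hlt : a < b generalizing a b
  · exact this b hb a ha hab.symm hf.symm (by omega)
  have hb := Finset.mem_range.1 hb
  simp only [Prod.mk.injEq] at hf
  obtain ⟨d, rfl⟩ := Nat.exists_eq_add_of_lt hlt
  obtain ⟨e, rfl⟩ := Nat.exists_eq_add_of_le (show a + d + 1 ≤ m by omega)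
  refine ⟨a, d + 1, e, σ a, by ring, by omega, ?_, ?_⟩
  · have := (Nat.modEq_iff_dvd' (by omega)).1 (show a ≡ a + d + 1 [MOD g] from hf.2)
    rwa [show a + d + 1 - a = d + 1 by omega] at this
  · rw [← hw, weight_add, add_assoc a d 1, weight_add]
    have h1 := weight_le_mpow A a σ
    have h2 := weight_le_mpow A (d + 1) fun l => σ (a + l)
    have h3 := weight_le_mpow A e fun l => σ (a + (d + 1) + l)
    simp only [add_zero] at h2 h3
    rw [← add_assoc a d 1, ← hf.1] at h2
    rw [← add_assoc a d 1, hσm, ← hf.1] at h3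
    rw [h0] at h1
    rw [← add_assoc a d 1]
    exact mul_le_mul' (mul_le_mul' h1 h2) h3

/-- Removing closed subwalks bounds the length of optimal walks in a residue class. -/
theorem exists_short_walk (hA : ∀ i j, A i j ≤ 1) {g : ℕ} (hg : 0 < g) (m : ℕ) (i j : V) :
    ∃ m' < Fintype.card V * g, m' ≡ m [MOD g] ∧ mpow A m i j ≤ mpow A m' i j := by
  have hpos : 0 < Fintype.card V := Fintype.card_pos_iff.2 ⟨i⟩
  have hmod : m % g < Fintype.card V * g :=
    (Nat.mod_lt m hg).trans_le (Nat.le_mul_of_pos_left g hpos)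
  induction m using Nat.strong_induction_on with
  | _ m ih =>
    by_cases hm : m < Fintype.card V * g
    · exact ⟨m, hm, rfl, le_rfl⟩
    by_cases hne : mpow A m i j = 0
    · exact ⟨m % g, hmod, Nat.mod_modEq m g, by simp [hne]⟩
    obtain ⟨a, d, b, k, hadb, hd, hgd, hle⟩ := exists_closed_subwalk hg (not_lt.1 hm) hne
    have hme : a + b ≡ m [MOD g] := by
      rw [← hadb, add_right_comm]
      exact (Nat.modEq_iff_dvd' (by omega)).2 (by simpa using hgd)
    obtain ⟨m', hm', hmm, hle'⟩ := ih (a + b) (by omega) (by rw [hme]; exact hmod)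
    refine ⟨m', hm', hmm.trans hme, hle.trans (le_trans ?_ hle')⟩
    refine le_trans ?_ (mpow_mul_le A a b i k j)
    exact mul_le_mul_left (mul_le_of_le_one_right' (mpow_le_one hA d k k)) _

theorem bddAbove_mpow (hA : ∀ i j, A i j ≤ 1) (i j : V) :
    BddAbove (Set.range fun m => mpow A m i j) :=
  ⟨1, by rintro _ ⟨m, rfl⟩; exact mpow_le_one hA m i j⟩

theorem mpow_le_kleeneStar (hA : ∀ i j, A i j ≤ 1) (m : ℕ) (i j : V) :
    mpow A m i j ≤ kleeneStar A i j :=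
  le_ciSup (bddAbove_mpow hA i j) m

theorem kleeneStar_le {i j : V} {x : ℝ≥0} (hx : ∀ m, mpow A m i j ≤ x) : kleeneStar A i j ≤ x :=
  ciSup_le hx

/-- Closed subwalks weigh at most `1`, so removing them (modulus `1`) leaves a finite maximum. -/
theorem exists_mpow_eq_kleeneStar (hA : ∀ i j, A i j ≤ 1) (i j : V) :
    ∃ m < Fintype.card V, mpow A m i j = kleeneStar A i j := by
  have hpos : 0 < Fintype.card V := Fintype.card_pos_iff.2 ⟨i⟩
  obtain ⟨m, hm, hmax⟩ := Finset.exists_max_image (Finset.range (Fintype.card V))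
    (fun m => mpow A m i j) ⟨0, Finset.mem_range.2 hpos⟩
  refine ⟨m, Finset.mem_range.1 hm, (mpow_le_kleeneStar hA m i j).antisymm (kleeneStar_le ?_)⟩
  intro r
  obtain ⟨r', hr', -, hle⟩ := exists_short_walk hA one_pos r i j
  exact hle.trans (hmax r' (Finset.mem_range.2 (by simpa using hr')))

end General

/-! ### Paths in digraphs -/

section Paths

variable {V : Type*} {E : V → V → Prop}

theorem hasPath_zero (E : V → V → Prop) (i : V) : HasPath E 0 i i :=
  ⟨fun _ => i, fun _ hl => absurd hl (Nat.not_lt_zero _), rfl, rfl⟩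

theorem hasPath_zero_iff {i j : V} : HasPath E 0 i j ↔ i = j := by
  constructor
  · rintro ⟨σ, -, h0, h1⟩
    exact h0.symm.trans h1
  · rintro rfl
    exact hasPath_zero E i

theorem hasPath_succ_iff {m : ℕ} {i j : V} :
    HasPath E (m + 1) i j ↔ ∃ k, HasPath E m i k ∧ E k j := by
  classical
  constructor
  · rintro ⟨σ, hσ, h0, h1⟩
    exact ⟨σ m, ⟨σ, fun l hl => hσ l (by omega), h0, rfl⟩, h1 ▸ hσ m (by omega)⟩
  · rintro ⟨k, ⟨σ, hσ, h0, h1⟩, hkj⟩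
    refine ⟨Function.update σ (m + 1) j, fun l hl => ?_, by simp [h0], by simp⟩
    rcases Nat.lt_succ_iff_lt_or_eq.1 hl with hl | rfl
    · rw [Function.update_of_ne (by omega), Function.update_of_ne (by omega)]
      exact hσ l hl
    · rw [Function.update_self, Function.update_of_ne (by omega), h1]
      exact hkj

theorem HasPath.trans {p q : ℕ} {i j k : V} (hp : HasPath E p i j) (hq : HasPath E q j k) :
    HasPath E (p + q) i k := by
  induction q generalizing k with
  | zero => rwa [hasPath_zero_iff.1 hq] at hp
  | succ q ih =>
    obtain ⟨l, hl, hlk⟩ := hasPath_succ_iff.1 hq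
    exact hasPath_succ_iff.2 ⟨l, ih hl, hlk⟩

end Paths

/-! ### The critical graph of a visualized matrix -/

section Critical

variable {V : Type*} {A : Matrix V V ℝ≥0}

theorem cycleMean_eq_one_iff {k : ℕ} (hk : 0 < k) {σ : ℕ → V} :
    cycleMean A k σ = 1 ↔ weight A k σ = 1 := by
  have hk' : (1 : ℝ) / k ≠ 0 := by positivity
  constructor
  · intro h1
    rw [cycleMean] at h1
    exact (NNReal.rpow_left_injective hk') (h1.trans (NNReal.one_rpow _).symm)
  · intro h1
    rw [cycleMean, h1, NNReal.one_rpow]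

theorem IsCritCycle.isCycle_critEdge {k : ℕ} {σ : ℕ → V} (hσ : IsCritCycle A k σ) :
    IsCycle (critEdge A) k σ :=
  ⟨hσ.1.1, fun l hl => ⟨k, σ, hσ, l, hl, rfl, rfl⟩, hσ.1.2.2⟩

theorem critEdge.mem_left {i j : V} (hij : critEdge A i j) : i ∈ critNodes A := by
  obtain ⟨k, σ, hσ, l, hl, hi, -⟩ := hij
  exact ⟨k, σ, hσ, l, hl, hi⟩

theorem isCritCycle_of_weight_eq_one (hvis : Visualized A) {k : ℕ} (hk : 0 < k) {σ : ℕ → V}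
    (hσ : σ k = σ 0) (hw : weight A k σ = 1) : IsCritCycle A k σ := by
  refine ⟨⟨hk, fun l hl h0 => ?_, hσ⟩, ?_⟩
  · rw [weight, Finset.prod_eq_zero (Finset.mem_range.2 hl) h0] at hw
    exact zero_ne_one hw
  · rw [(cycleMean_eq_one_iff hk).2 hw]
    exact hvis.definite.symm

theorem B_le_one (hvis : Visualized A) (s t : NonCrit A) : B A s t ≤ 1 := hvis.le_one _ _

variable [Fintype V]

theorem mpow_eq_one_of_hasPath (hvis : Visualized A) {m : ℕ} {i j : V}
    (hp : HasPath (critEdge A) m i j) : mpow A m i j = 1 := by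
  refine (mpow_le_one hvis.le_one m i j).antisymm ?_
  induction m generalizing j with
  | zero => rw [hasPath_zero_iff.1 hp, mpow_zero_self]
  | succ m ih =>
    obtain ⟨k, hk, hkj⟩ := hasPath_succ_iff.1 hp
    refine le_trans ?_ (mul_le_mpow_succ A m i k j)
    rw [hvis.eq_one k j hkj, mul_one]
    exact ih hk

theorem critEdge_of_mpow_eq_one (hvis : Visualized A) {d : ℕ} {i j : V} (hij : A i j = 1)
    (hd : mpow A d j i = 1) : critEdge A i j := by
  obtain ⟨σ, h0, h1, hw⟩ := exists_weight_eq_mpow (A := A) (m := d) (i := j) (j := i)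
    (by rw [hd]; exact one_ne_zero)
  -- The closed walk takes the edge from `i` to `j` and then follows `σ` back.
  refine ⟨d + 1, fun l => Nat.casesOn l i σ,
    isCritCycle_of_weight_eq_one hvis d.succ_pos h1 ?_, 0, d.succ_pos, rfl, h0⟩
  rw [weight, Finset.prod_range_succ']
  change weight A d σ * A i (σ 0) = 1
  rw [hw, hd, h0, hij, one_mul]

/-- With all entries at most `1`, a walk of weight `1` uses only edges of weight `1`. The return
walk closes each of them into a cycle of weight `1`, which is critical. -/
theorem hasPath_of_mpow_eq_one (hvis : Visualized A) {p d : ℕ} {i j : V}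
    (hp : mpow A p i j = 1) (hd : mpow A d j i = 1) : HasPath (critEdge A) p i j := by
  have hle := mpow_le_one hvis.le_one
  induction p generalizing d j with
  | zero =>
    rw [hasPath_zero_iff]
    by_contra hij
    rw [mpow_zero_ne A hij] at hp
    exact zero_ne_one hp
  | succ p ih =>
    obtain ⟨k, hk⟩ := exists_mpow_succ_eq A p i j
    rw [hp] at hk
    have h1 : mpow A p i k = 1 := (hle p i k).antisymm
      (hk.trans_le (mul_le_of_le_one_right' (hvis.le_one k j)))
    have h2 : A k j = 1 := by rw [h1, one_mul] at hk; exact hk.symm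
    have h3 : mpow A (1 + d) k i = 1 := (hle _ k i).antisymm <| by
      refine le_trans ?_ (mpow_mul_le A 1 d k j i)
      rw [hd, mul_one, ← h2]
      exact le_mpow_one A k j
    have h4 : mpow A (d + p) j k = 1 := (hle _ j k).antisymm <| by
      refine le_trans ?_ (mpow_mul_le A d p j i k)
      rw [hd, h1, one_mul]
    exact hasPath_succ_iff.2 ⟨k, ih h1 h3, critEdge_of_mpow_eq_one hvis h2 h4⟩

theorem mpow_self_lt_one (hvis : Visualized A) {d : ℕ} (hd : 0 < d) {s : V}
    (hs : s ∉ critNodes A) : mpow A d s s < 1 := by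
  refine lt_of_le_of_ne (mpow_le_one hvis.le_one d s s) fun h1 => hs ?_
  obtain ⟨σ, h0, hσ, hw⟩ := exists_weight_eq_mpow (A := A) (m := d) (i := s) (j := s)
    (by rw [h1]; exact one_ne_zero)
  exact ⟨d, σ, isCritCycle_of_weight_eq_one hvis hd (hσ.trans h0.symm) (hw.trans h1), 0, hd, h0⟩

theorem mpow_B_le (A : Matrix V V ℝ≥0) (m : ℕ) (s t : NonCrit A) :
    mpow (B A) m s t ≤ mpow A m s.1 t.1 := by
  induction m generalizing t with
  | zero =>
    by_cases hst : s = t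
    · simp [hst, mpow_zero_self]
    · simp [mpow_zero_ne (B A) hst]
  | succ m ih =>
    obtain ⟨k, hk⟩ := exists_mpow_succ_eq (B A) m s t
    rw [hk]
    exact (mul_le_mul_left (ih k) _).trans (mul_le_mpow_succ A m s.1 k.1 t.1)

/-- Optimal walks in the non-critical part are shorter than the number of its nodes. -/
theorem lt_card_of_mpow_B_eq_kleeneStar (hvis : Visualized A) {m : ℕ} {s t : NonCrit A}
    (hne : mpow (B A) m s t ≠ 0) (hm : mpow (B A) m s t = kleeneStar (B A) s t) :
    m < Fintype.card (NonCrit A) := by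
  by_contra! hlt
  obtain ⟨a, d, b, k, -, hd, -, hle⟩ := exists_closed_subwalk one_pos (by simpa using hlt) hne
  have h1 : mpow (B A) d k k < 1 := (mpow_B_le A d k k).trans_lt (mpow_self_lt_one hvis hd k.2)
  have h2 : mpow (B A) a s k * mpow (B A) b k t ≤ mpow (B A) m s t := by
    rw [hm]
    exact (mpow_mul_le (B A) a b s k t).trans (mpow_le_kleeneStar (B_le_one hvis) _ s t)
  -- Cutting out the closed piece would strictly improve the optimal nonzero weight.
  have h3 : mpow (B A) m s t ≤ mpow (B A) m s t * mpow (B A) d k k := by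
    refine hle.trans ?_
    rw [mul_right_comm]
    exact mul_le_mul_left h2 _
  exact absurd h3 (not_le.2 (mul_lt_of_lt_one_right (pos_iff_ne_zero.2 hne) h1))

theorem mem_U_iff (hvis : Visualized A) {m : ℕ} {s t : NonCrit A} :
    m ∈ U A s t ↔ m < Fintype.card (NonCrit A) ∧ mpow (B A) m s t = kleeneStar (B A) s t := by
  classical
  simp only [U, Finset.mem_filter, Finset.mem_range]
  refine and_congr_right fun hm => ⟨fun hmax => ?_, fun heq m' _ => ?_⟩
  · obtain ⟨m', hm', heq⟩ := exists_mpow_eq_kleeneStar (B_le_one hvis) s t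
    exact (mpow_le_kleeneStar (B_le_one hvis) m s t).antisymm (heq ▸ hmax m' hm')
  · rw [heq]
    exact mpow_le_kleeneStar (B_le_one hvis) m' s t

/-- High powers of the non-critical part are arbitrarily small. -/
theorem exists_mpow_B_le (hvis : Visualized A) {ε : ℝ≥0} (hε : 0 < ε) :
    ∃ R, ∀ r ≥ R, ∀ s t, mpow (B A) r s t ≤ ε := by
  classical
  set n := Fintype.card (NonCrit A) with hn
  have hB := B_le_one hvis
  set δ : ℝ≥0 := Finset.univ.sup fun x : NonCrit A × NonCrit A => mpow (B A) n x.1 x.2 with hδ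
  have hle : ∀ s t, mpow (B A) n s t ≤ δ := fun s t =>
    Finset.le_sup (f := fun x : NonCrit A × NonCrit A => mpow (B A) n x.1 x.2)
      (Finset.mem_univ (s, t))
  have hδ1 : δ < 1 := by
    -- An entry `1` in the `n`-th power would be optimal, against the length bound `m < n` for
    -- optimal walks.
    refine (Finset.sup_lt_iff (by simp)).2 fun x _ => ?_
    refine lt_of_le_of_ne (mpow_le_one hB n _ _) fun h1 => ?_
    refine absurd (lt_card_of_mpow_B_eq_kleeneStar hvis (m := n) (s := x.1) (t := x.2)
      (by rw [h1]; exact one_ne_zero) ?_) (lt_irrefl _)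
    refine (mpow_le_kleeneStar hB n _ _).antisymm ?_
    rw [h1]
    exact kleeneStar_le fun m => mpow_le_one hB m _ _
  obtain ⟨N, hN⟩ := exists_pow_lt_of_lt_one hε hδ1
  have hpow : ∀ q a s t, mpow (B A) (a + q * n) s t ≤ δ ^ q := by
    intro q
    induction q with
    | zero => intro a s t; simpa using mpow_le_one hB _ s t
    | succ q ih =>
      intro a s t
      obtain ⟨k, hk⟩ := exists_mpow_add_le (B A) (a + q * n) n s t
      rw [show a + (q + 1) * n = a + q * n + n by ring, pow_succ]
      exact hk.trans (mul_le_mul' (ih a s k) (hle k t))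
  refine ⟨N * n, fun r hr s t => ?_⟩
  obtain ⟨a, rfl⟩ := Nat.exists_eq_add_of_le' hr
  exact (hpow N a s t).trans hN.le

/-- A walk passes through a critical node or stays in the non-critical part. -/
theorem mpow_le_through_crit_or_B (A : Matrix V V ℝ≥0) (r : ℕ) (i j : V) :
    (∃ k ∈ critNodes A, ∃ p q, p + q = r ∧ mpow A r i j ≤ mpow A p i k * mpow A q k j) ∨
      ∃ (hi : i ∉ critNodes A) (hj : j ∉ critNodes A),
        mpow A r i j ≤ mpow (B A) r ⟨i, hi⟩ ⟨j, hj⟩ := by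
  induction r generalizing j with
  | zero =>
    by_cases hi : i ∈ critNodes A
    · exact Or.inl ⟨i, hi, 0, 0, rfl, by simp [mpow_zero_self]⟩
    by_cases hj : j ∈ critNodes A
    · exact Or.inl ⟨j, hj, 0, 0, rfl, by simp [mpow_zero_self]⟩
    refine Or.inr ⟨hi, hj, ?_⟩
    by_cases hij : i = j
    · subst hij; simp [mpow_zero_self]
    · simp [mpow_zero_ne A hij]
  | succ r ih =>
    by_cases hj : j ∈ critNodes A
    · exact Or.inl ⟨j, hj, r + 1, 0, rfl, by simp [mpow_zero_self]⟩
    obtain ⟨l, hl⟩ := exists_mpow_succ_eq A r i j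
    rcases ih l with ⟨k, hk, p, q, hpq, hle⟩ | ⟨hi, hl', hle⟩
    · refine Or.inl ⟨k, hk, p, q + 1, by omega, ?_⟩
      rw [hl]
      refine (mul_le_mul_left hle _).trans ?_
      rw [mul_assoc]
      exact mul_le_mul_right (mul_le_mpow_succ A q k l j) _
    · refine Or.inr ⟨hi, hj, ?_⟩
      rw [hl]
      exact (mul_le_mul_left hle _).trans (mul_le_mpow_succ (B A) r ⟨i, hi⟩ ⟨l, hl'⟩ ⟨j, hj⟩)

/-- Decomposition of a walk from a critical to a non-critical node at its last critical node. -/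
theorem exists_last_exit {r : ℕ} {i : V} (hi : i ∈ critNodes A) {t : NonCrit A}
    (hne : mpow A r i t.1 ≠ 0) :
    ∃ k ∈ critNodes A, ∃ s : NonCrit A, ∃ p m, p + 1 + m = r ∧
      mpow A r i t.1 ≤ mpow A p i k * A k s.1 * mpow (B A) m s t := by
  induction r generalizing t with
  | zero => exact absurd (mpow_zero_ne A (ne_of_mem_of_not_mem hi t.2)) hne
  | succ r ih =>
    obtain ⟨l, hl⟩ := exists_mpow_succ_eq A r i t.1
    by_cases hlc : l ∈ critNodes A
    · exact ⟨l, hlc, t, r, 0, rfl, by rw [hl, mpow_zero_self, mul_one]⟩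
    obtain ⟨k, hk, s, p, m, hpm, hle⟩ := ih (t := ⟨l, hlc⟩) fun h0 => hne (by rw [hl, h0, zero_mul])
    refine ⟨k, hk, s, p, m + 1, by omega, ?_⟩
    rw [hl]
    refine (mul_le_mul_left hle _).trans ?_
    rw [mul_assoc]
    exact mul_le_mul_right (mul_le_mpow_succ (B A) m s ⟨l, hlc⟩ t) _

end Critical

/-! ### Cyclicity and ultimate periodicity -/

section Periodicity

variable {V : Type*} {A : Matrix V V ℝ≥0}

theorem cyclicity_dvd {m : ℕ} {i : V} (hp : HasPath (critEdge A) m i i) : cyclicity A ∣ m := by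
  rcases Nat.eq_zero_or_pos m with rfl | hm
  · exact dvd_zero _
  obtain ⟨σ, hσ, h0, h1⟩ := hp
  exact Nat.setGcd_dvd_of_mem ⟨σ, hm, hσ, h1.trans h0.symm⟩

theorem cyclicity_pos (hne : (critNodes A).Nonempty) : 0 < cyclicity A := by
  obtain ⟨i, k, σ, hσ, -⟩ := hne
  have hdvd : cyclicity A ∣ k := Nat.setGcd_dvd_of_mem ⟨σ, hσ.isCycle_critEdge⟩
  exact Nat.pos_of_dvd_of_pos hdvd hσ.1.1

theorem critEdge.mem_right {i j : V} (hij : critEdge A i j) : j ∈ critNodes A := by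
  obtain ⟨k, σ, hσ, l, hl, -, hj⟩ := hij
  rcases Nat.lt_or_ge (l + 1) k with hlt | hge
  · exact ⟨k, σ, hσ, l + 1, hlt, hj⟩
  · refine ⟨k, σ, hσ, 0, hσ.1.1, ?_⟩
    rw [← hj, show l + 1 = k by omega, hσ.1.2.2]

theorem HasPath.mem_critNodes {m : ℕ} {i j : V} (hp : HasPath (critEdge A) m i j)
    (hi : i ∈ critNodes A) : j ∈ critNodes A := by
  cases m with
  | zero => exact hasPath_zero_iff.1 hp ▸ hi
  | succ m =>
    obtain ⟨k, -, hkj⟩ := hasPath_succ_iff.1 hp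
    exact hkj.mem_right

/-- The lengths of closed critical paths at `i` form an additive submonoid of `ℕ`, which contains
all large multiples of its gcd. -/
theorem exists_forall_hasPath_self (hconn : CritStronglyConnected A) {i : V}
    (hi : i ∈ critNodes A) :
    ∃ N, ∀ m ≥ N, cyclicity A ∣ m → HasPath (critEdge A) m i i := by
  let S : AddSubmonoid ℕ :=
    { carrier := {m | HasPath (critEdge A) m i i}
      zero_mem' := hasPath_zero _ i
      add_mem' := fun ha hb => HasPath.trans ha hb }
  obtain ⟨N, hN⟩ := Nat.exists_mem_closure_of_ge (S : Set ℕ)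
  -- A round trip from `i` to any critical cycle, made with and without traversing it, shows that
  -- the gcd at `i` divides the length of that cycle.
  have hdvd : Nat.setGcd (S : Set ℕ) ∣ cyclicity A := by
    refine Nat.dvd_setGcd_iff.2 ?_
    rintro k ⟨σ, hk, hσ, hcyc⟩
    have hj : σ 0 ∈ critNodes A := (hσ 0 hk).mem_left
    obtain ⟨p, hp⟩ := hconn.2 i hi _ hj
    obtain ⟨q, hq⟩ := hconn.2 _ hj i hi
    have h1 : Nat.setGcd (S : Set ℕ) ∣ p + q := Nat.setGcd_dvd_of_mem (hp.trans hq)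
    have h2 : Nat.setGcd (S : Set ℕ) ∣ p + k + q :=
      Nat.setGcd_dvd_of_mem ((hp.trans ⟨σ, hσ, rfl, hcyc⟩).trans hq)
    rw [add_right_comm] at h2
    exact (Nat.dvd_add_right h1).1 h2
  refine ⟨N, fun m hm hγ => ?_⟩
  have := hN m hm (hdvd.trans hγ)
  rwa [AddSubmonoid.closure_eq] at this

theorem exists_forall_hasPath (hconn : CritStronglyConnected A) {i k : V}
    (hi : i ∈ critNodes A) (hk : k ∈ critNodes A) {q : ℕ} (hq : HasPath (critEdge A) q k i) :
    ∃ N, ∀ m ≥ N, cyclicity A ∣ m + q → HasPath (critEdge A) m i k := by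
  obtain ⟨N, hN⟩ := exists_forall_hasPath_self hconn hi
  obtain ⟨p, hp⟩ := hconn.2 i hi k hk
  refine ⟨N + p, fun m hm hγ => ?_⟩
  obtain ⟨d, rfl⟩ := Nat.exists_eq_add_of_le' (show p ≤ m by omega)
  refine (hN d (by omega) ?_).trans hp
  rw [add_assoc] at hγ
  exact (Nat.dvd_add_left (cyclicity_dvd (hp.trans hq))).1 hγ

/-- Moving inside a cyclic class costs a multiple of `γ`, so the class representatives can be
replaced by `k` and `i` themselves. -/
theorem mem_classBefore_iff (hconn : CritStronglyConnected A) {m : ℕ} {i k : V}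
    (hi : i ∈ critNodes A) :
    k ∈ classBefore A m i ↔
      k ∈ critNodes A ∧ ∃ q, q ≡ m [MOD cyclicity A] ∧ HasPath (critEdge A) q k i := by
  refine and_congr_right fun hk => ⟨?_, ?_⟩
  · rintro ⟨k', ⟨a, ha, ha0⟩, i', ⟨b, hb, hb0⟩, c, hc, hcm⟩
    obtain ⟨d, hd⟩ := hconn.2 i' (hb.mem_critNodes hi) i hi
    refine ⟨a + c + d, ?_, (ha.trans hc).trans hd⟩
    have hd0 : d ≡ 0 [MOD cyclicity A] := by
      have hbd : b + d ≡ 0 [MOD cyclicity A] :=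
        Nat.modEq_zero_iff_dvd.2 (cyclicity_dvd (hb.trans hd))
      exact Nat.ModEq.add_left_cancel hb0 hbd
    simpa using (ha0.add hcm).add hd0
  · rintro ⟨q, hq, hp⟩
    exact ⟨k, ⟨0, hasPath_zero _ _, rfl⟩, i, ⟨0, hasPath_zero _ _, rfl⟩, q, hp, hq⟩

variable [Fintype V]

theorem mpow_mul_ne_zero {p q : ℕ} {i k j : V} (hp : mpow A p i k ≠ 0) (hq : mpow A q k j ≠ 0) :
    mpow A (p + q) i j ≠ 0 :=
  ((pos_iff_ne_zero.2 (mul_ne_zero hp hq)).trans_le (mpow_mul_le A p q i k j)).ne'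

theorem mpow_mul_self_ne_zero {d : ℕ} {k : V} (hd : mpow A d k k ≠ 0) (n : ℕ) :
    mpow A (n * d) k k ≠ 0 := by
  induction n with
  | zero => simp [mpow_zero_self]
  | succ n ih => rw [Nat.succ_mul]; exact mpow_mul_ne_zero ih hd

theorem mpow_ne_zero_of_hasPath {m : ℕ} {i j : V} (hp : HasPath (edge A) m i j) :
    mpow A m i j ≠ 0 := by
  induction m generalizing j with
  | zero => rw [hasPath_zero_iff.1 hp, mpow_zero_self]; exact one_ne_zero
  | succ m ih =>
    obtain ⟨k, hk, hkj⟩ := hasPath_succ_iff.1 hp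
    exact ((pos_iff_ne_zero.2 (mul_ne_zero (ih hk) hkj)).trans_le
      (mul_le_mpow_succ A m i k j)).ne'

/-- The limit is the best weight of a walk through a critical node with length in the given residue
class; short pieces on either side suffice. Walks avoiding critical nodes eventually weigh less, and
padding with critical loops of weight `1` attains the limit at every large length. -/
theorem exists_forall_mpow_eq (hirr : Irred A) (hvis : Visualized A)
    (hconn : CritStronglyConnected A) (i j : V) (ρ : ℕ) :
    ∃ M R, ∀ r ≥ R, r ≡ ρ [MOD cyclicity A] → mpow A r i j = M := by
  classical
  have hle := hvis.le_one
  have hγ := cyclicity_pos hconn.1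
  set γ := cyclicity A with hγdef
  set N := Fintype.card V * γ with hN
  set S : Finset (V × ℕ × ℕ) :=
    ((Finset.univ : Finset V) ×ˢ Finset.range N ×ˢ Finset.range N).filter
      fun x => x.1 ∈ critNodes A ∧ x.2.1 + x.2.2 ≡ ρ [MOD γ] with hS
  set f : V × ℕ × ℕ → ℝ≥0 := fun x => mpow A x.2.1 i x.1 * mpow A x.2.2 x.1 j with hf
  have hub : ∀ k ∈ critNodes A, ∀ p q, p + q ≡ ρ [MOD γ] →
      mpow A p i k * mpow A q k j ≤ S.sup f := by
    intro k hk p q hpq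
    obtain ⟨p', hp', hpm, hple⟩ := exists_short_walk hle hγ p i k
    obtain ⟨q', hq', hqm, hqle⟩ := exists_short_walk hle hγ q k j
    refine (mul_le_mul' hple hqle).trans (Finset.le_sup (f := f) (b := (k, p', q')) ?_)
    simp only [hS, Finset.mem_filter, Finset.mem_product, Finset.mem_univ, Finset.mem_range,
      true_and]
    exact ⟨⟨hp', hq'⟩, hk, (hpm.add hqm).trans hpq⟩
  rcases eq_or_ne (S.sup f) 0 with h0 | h0
  · refine ⟨0, 0, fun r _ hr => ?_⟩
    by_contra hne
    obtain ⟨k, hk⟩ := hconn.1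
    obtain ⟨u, hu⟩ := hirr j k
    obtain ⟨v, hv⟩ := hirr k j
    have hu := mpow_ne_zero_of_hasPath hu
    have hv := mpow_ne_zero_of_hasPath hv
    -- If the limit is `0`, a nonzero walk is extended by `γ` round trips from `j` through `k`,
    -- which keeps the residue; cutting at the last visit to `k` leaves `γ - 1` full loops and the
    -- final `v`.
    have h1 := mpow_mul_ne_zero (mpow_mul_ne_zero hne hu)
      (mpow_mul_self_ne_zero (mpow_mul_ne_zero hv hu) (γ - 1))
    refine mul_ne_zero h1 hv (le_zero_iff.1 (h0 ▸ hub k hk _ v ?_))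
    have hsum : r + u + (γ - 1) * (v + u) + v = r + γ * (v + u) := by
      obtain ⟨g, hg⟩ := Nat.exists_eq_succ_of_ne_zero hγ.ne'
      rw [hg, Nat.succ_sub_one, Nat.succ_mul]
      ring
    rw [hsum]
    exact (Nat.modEq_zero_iff_dvd.2 (dvd_mul_right γ (v + u))).add_left r |>.trans hr
  · have hSne : S.Nonempty := by
      rw [Finset.nonempty_iff_ne_empty]
      intro hempty
      exact h0 (by rw [hempty, Finset.sup_empty]; rfl)
    obtain ⟨⟨k, p, q⟩, hmem, hmax⟩ := Finset.exists_mem_eq_sup S hSne f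
    simp only [hS, Finset.mem_filter] at hmem
    obtain ⟨-, hk, hpq⟩ := hmem
    obtain ⟨D, hD⟩ := exists_forall_hasPath_self hconn hk
    obtain ⟨R, hR⟩ := exists_mpow_B_le hvis (pos_iff_ne_zero.2 h0)
    refine ⟨S.sup f, R + D + p + q, fun r hr hrρ => le_antisymm ?_ ?_⟩
    · rcases mpow_le_through_crit_or_B A r i j with ⟨k', hk', p', q', rfl, hle'⟩ | ⟨hi, hj, hle'⟩
      · exact hle'.trans (hub k' hk' p' q' hrρ)
      · exact hle'.trans (hR r (by omega) _ _)
    · obtain ⟨d, rfl⟩ := Nat.exists_eq_add_of_le' (show p + q ≤ r by omega)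
      have hd : γ ∣ d := Nat.modEq_zero_iff_dvd.1 <|
        Nat.ModEq.add_right_cancel hpq (by simpa using hrρ)
      have h1 := mpow_eq_one_of_hasPath hvis (hD d (by omega) hd)
      rw [hmax, show d + (p + q) = p + d + q by ring]
      refine le_trans ?_ (mpow_mul_le A (p + d) q i k j)
      refine mul_le_mul_left (le_trans ?_ (mpow_mul_le A p d i k k)) _
      rw [h1, mul_one]

/-- The powers of an irreducible visualized matrix are ultimately periodic. -/
theorem mpow_add_cyclicity (hirr : Irred A) (hvis : Visualized A)
    (hconn : CritStronglyConnected A) {r : ℕ} (hr : transient A ≤ r) :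
    mpow A (r + cyclicity A) = mpow A r := by
  have hγ := cyclicity_pos hconn.1
  have hev : ∀ᶠ r in Filter.atTop, ∀ i j, ∀ ρ ∈ Finset.range (cyclicity A),
      r ≡ ρ [MOD cyclicity A] → mpow A (r + cyclicity A) i j = mpow A r i j := by
    refine Filter.eventually_all.2 fun i => Filter.eventually_all.2 fun j =>
      (Filter.eventually_all_finset _).2 fun ρ _ => ?_
    obtain ⟨M, R, hM⟩ := exists_forall_mpow_eq hirr hvis hconn i j ρ
    filter_upwards [Filter.eventually_ge_atTop R] with r hr hρ
    rw [hM r hr hρ, hM _ (by omega) ((Nat.add_modEq_right (a := r)).trans hρ)]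
  obtain ⟨T, hT⟩ := Filter.eventually_atTop.1 hev
  -- The transient is an `sInf` in `ℕ`; it has its defining property only because this set is
  -- nonempty.
  have hne : {T | ∀ r ≥ T, mpow A (r + cyclicity A) = mpow A r}.Nonempty := by
    refine ⟨T, fun r hr => Matrix.ext fun i j => ?_⟩
    exact hT r hr i j (r % cyclicity A) (Finset.mem_range.2 (Nat.mod_lt r hγ))
      (Nat.mod_modEq r _).symm
  exact Nat.sInf_mem hne r hr

theorem mpow_add_mul_cyclicity (hirr : Irred A) (hvis : Visualized A)
    (hconn : CritStronglyConnected A) {r : ℕ} (hr : transient A ≤ r) (n : ℕ) :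
    mpow A (r + n * cyclicity A) = mpow A r := by
  induction n with
  | zero => simp
  | succ n ih =>
    rw [Nat.succ_mul, ← add_assoc, mpow_add_cyclicity hirr hvis hconn (by omega), ih]

end Periodicity

/-! ### The core matrix -/

section Core

variable {V : Type*} [Fintype V] {A : Matrix V V ℝ≥0}

theorem core_le_one (hvis : Visualized A) (p q : Option (NonCrit A)) : core A p q ≤ 1 :=
  Finset.sup_le fun i _ => Finset.sup_le fun j _ => hvis.le_one i j

theorem core_some_some (A : Matrix V V ℝ≥0) (s t : NonCrit A) :
    core A (some s) (some t) = B A s t := by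
  simp [core, block, B]

theorem le_h {k : V} (hk : k ∈ critNodes A) (t : NonCrit A) : A k t.1 ≤ h A t := by
  simp only [h, core, block, Finset.sup_singleton]
  exact Finset.le_sup (f := fun k => A k t.1) (by simpa using hk)

theorem h_le {t : NonCrit A} {x : ℝ≥0} (hx : ∀ k ∈ critNodes A, A k t.1 ≤ x) : h A t ≤ x := by
  simp only [h, core, block, Finset.sup_singleton]
  exact Finset.sup_le fun k hk => hx k (by simpa using hk)

theorem mem_argmaxCol_iff {k : V} {s : NonCrit A} :
    k ∈ argmaxCol A s.1 ↔ k ∈ critNodes A ∧ A k s.1 = h A s :=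
  and_congr_right fun hk =>
    ⟨fun hmax => (le_h hk s).antisymm (h_le hmax), fun heq _ hk' => heq ▸ le_h hk' s⟩

theorem mpow_B_le_mpow_core (A : Matrix V V ℝ≥0) (m : ℕ) (s t : NonCrit A) :
    mpow (B A) m s t ≤ mpow (core A) m (some s) (some t) := by
  induction m generalizing t with
  | zero =>
    by_cases hst : s = t
    · simp [hst, mpow_zero_self]
    · simp [mpow_zero_ne (B A) hst]
  | succ m ih =>
    obtain ⟨k, hk⟩ := exists_mpow_succ_eq (B A) m s t
    rw [hk, ← core_some_some]
    exact (mul_le_mul_left (ih k) _).trans (mul_le_mpow_succ (core A) m _ _ _)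

theorem h_mul_kleeneStar_le (hvis : Visualized A) (s t : NonCrit A) :
    h A s * kleeneStar (B A) s t ≤ kleeneStar (core A) none (some t) := by
  obtain ⟨m, -, hm⟩ := exists_mpow_eq_kleeneStar (B_le_one hvis) s t
  rw [← hm]
  refine le_trans ?_ (mpow_le_kleeneStar (core_le_one hvis) (1 + m) none (some t))
  refine le_trans ?_ (mpow_mul_le (core A) 1 m none (some s) (some t))
  exact mul_le_mul' (le_mpow_one (core A) none (some s)) (mpow_B_le_mpow_core A m s t)

/-- Only what follows the last visit to `μ` matters: the part before it weighs at most `1`. -/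
theorem exists_mpow_core_le (hvis : Visualized A) (r : ℕ) (t : NonCrit A) :
    ∃ s, mpow (core A) r none (some t) ≤ h A s * kleeneStar (B A) s t := by
  induction r generalizing t with
  | zero => exact ⟨t, by simp [mpow_zero_ne (core A) (Option.some_ne_none t).symm]⟩
  | succ r ih =>
    obtain ⟨k, hk⟩ := exists_mpow_succ_eq (core A) r none (some t)
    rw [hk]
    cases k with
    | none =>
      refine ⟨t, mul_le_mul' (mpow_le_one (core_le_one hvis) r _ _) le_rfl |>.trans ?_⟩
      rw [one_mul]
      refine le_mul_of_one_le_right' ?_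
      exact (mpow_zero_self (B A) t).symm.trans_le (mpow_le_kleeneStar (B_le_one hvis) 0 t t)
    | some l =>
      obtain ⟨s, hs⟩ := ih l
      refine ⟨s, (mul_le_mul_left hs _).trans ?_⟩
      rw [mul_assoc, core_some_some]
      refine mul_le_mul_right ?_ _
      obtain ⟨m, -, hm⟩ := exists_mpow_eq_kleeneStar (B_le_one hvis) s l
      rw [← hm]
      exact (mul_le_mpow_succ (B A) m s l t).trans (mpow_le_kleeneStar (B_le_one hvis) _ s t)

/-- The maximum defining `W` is the core star entry, so membership becomes an equation. -/
theorem mem_W_iff (hvis : Visualized A) {s t : NonCrit A} :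
    s ∈ W A t ↔ h A s * kleeneStar (B A) s t = kleeneStar (core A) none (some t) := by
  simp only [W, Finset.mem_filter, Finset.mem_univ, true_and]
  constructor
  · intro hmax
    refine (h_mul_kleeneStar_le hvis s t).antisymm (kleeneStar_le fun r => ?_)
    obtain ⟨s', hs'⟩ := exists_mpow_core_le hvis r t
    exact hs'.trans (hmax s')
  · intro heq s'
    rw [heq]
    exact h_mul_kleeneStar_le hvis s' t

theorem last_exit_le (hvis : Visualized A) {k : V} (hk : k ∈ critNodes A) (m : ℕ)
    (s t : NonCrit A) : A k s.1 * mpow (B A) m s t ≤ kleeneStar (core A) none (some t) :=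
  (mul_le_mul' (le_h hk s) (mpow_le_kleeneStar (B_le_one hvis) m s t)).trans
    (h_mul_kleeneStar_le hvis s t)

theorem mpow_le_kleeneStar_core (hvis : Visualized A) (r : ℕ) {i : V} (hi : i ∈ critNodes A)
    (t : NonCrit A) : mpow A r i t.1 ≤ kleeneStar (core A) none (some t) := by
  by_cases hne : mpow A r i t.1 = 0
  · rw [hne]; exact zero_le
  obtain ⟨k, hk, s, p, m, -, hle⟩ := exists_last_exit hi hne
  rw [mul_assoc] at hle
  exact hle.trans ((mul_le_of_le_one_left' (mpow_le_one hvis.le_one p i k)).trans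
    (last_exit_le hvis hk m s t))

theorem kleeneStar_core_ne_zero (hirr : Irred A) (hvis : Visualized A) {i : V}
    (hi : i ∈ critNodes A) (t : NonCrit A) : kleeneStar (core A) none (some t) ≠ 0 := by
  obtain ⟨r, hr⟩ := hirr i t.1
  exact ((pos_iff_ne_zero.2 (mpow_ne_zero_of_hasPath hr)).trans_le
    (mpow_le_kleeneStar_core hvis r hi t)).ne'

theorem sup_eq_true_iff {ι : Type*} (S : Finset ι) (f : ι → Bool) :
    S.sup f = true ↔ ∃ a ∈ S, f a = true := by
  have hb : ∀ b : Bool, b = true ↔ false < b := by decide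
  rw [hb, Finset.lt_sup_iff]
  simp only [← hb]

theorem G_eq_true_iff {t : NonCrit A} {i : V} :
    G A t i = true ↔
      ∃ s ∈ W A t, ∃ m ∈ U A s t, (classBefore A (m + 1) i ∩ argmaxCol A s.1).Nonempty := by
  simp only [G, sup_eq_true_iff, P, decide_eq_true_eq]

/-- Turns a tight bound on a product into tight bounds on its factors; it fails when the bound is
`0`. -/
theorem eq_and_eq_of_mul_le_mul {a b c d : ℝ≥0} (hac : a ≤ c) (hbd : b ≤ d) (hne : c * d ≠ 0)
    (hle : c * d ≤ a * b) : a = c ∧ b = d := by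
  have hc : 0 < c := pos_iff_ne_zero.2 (left_ne_zero_of_mul hne)
  have hd : 0 < d := pos_iff_ne_zero.2 (right_ne_zero_of_mul hne)
  refine ⟨hac.antisymm ?_, hbd.antisymm ?_⟩
  · exact le_of_mul_le_mul_right (hle.trans (mul_le_mul_right hbd a)) hd
  · exact le_of_mul_le_mul_left (hle.trans (mul_le_mul_left hac b)) hc

end Core

end MaxAlg

/-! ### The equivalence -/

theorem proposition6p6 {V : Type*} [Fintype V] (A : Matrix V V ℝ≥0)
    (hirr : MaxAlg.Irred A) (hvis : MaxAlg.Visualized A)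
    (hconn : MaxAlg.CritStronglyConnected A)
    (t : MaxAlg.NonCrit A) (r : ℕ) (hr : MaxAlg.transient A ≤ r)
    (hγ : MaxAlg.cyclicity A ∣ r) (i : V) (hi : i ∈ MaxAlg.critNodes A) :
    t ∈ MaxAlg.K A r i ↔ MaxAlg.G A t i = true := by
  open MaxAlg in
  have hα := kleeneStar_core_ne_zero hirr hvis hi t
  rw [G_eq_true_iff]
  constructor
  · intro ht
    have ht : mpow A r i t.1 = kleeneStar (core A) none (some t) := ht
    obtain ⟨k, hk, s, p, m, hpm, hle⟩ := exists_last_exit hi (ht ▸ hα)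
    rw [ht, mul_assoc] at hle
    have hsm := last_exit_le hvis hk m s t
    obtain ⟨hp, hsm⟩ := eq_and_eq_of_mul_le_mul (mpow_le_one hvis.le_one p i k) hsm
      (by rwa [one_mul]) (by rwa [one_mul])
    have hs : h A s * kleeneStar (B A) s t = kleeneStar (core A) none (some t) :=
      (h_mul_kleeneStar_le hvis s t).antisymm <| hsm ▸
        mul_le_mul' (le_h hk s) (mpow_le_kleeneStar (B_le_one hvis) m s t)
    obtain ⟨hks, hm⟩ := eq_and_eq_of_mul_le_mul (le_h hk s)
      (mpow_le_kleeneStar (B_le_one hvis) m s t) (hs ▸ hα) (by rw [hs, hsm])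
    have hm0 : mpow (B A) m s t ≠ 0 := right_ne_zero_of_mul (hsm ▸ hα)
    obtain ⟨q, hq⟩ := hconn.2 k hk i hi
    have hpath := hasPath_of_mpow_eq_one hvis hp (mpow_eq_one_of_hasPath hvis hq)
    refine ⟨s, (mem_W_iff hvis).2 hs, m,
      (mem_U_iff hvis).2 ⟨lt_card_of_mpow_B_eq_kleeneStar hvis hm0 hm, hm⟩, k,
      (mem_classBefore_iff hconn hi).2 ⟨hk, q, ?_, hq⟩, mem_argmaxCol_iff.2 ⟨hk, hks⟩⟩
    -- Both `p + q`, the length of a closed critical path, and `p + (m + 1) = r` are divisible by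
    -- `γ`.
    refine Nat.ModEq.add_left_cancel' p ?_
    rw [show p + (m + 1) = r by omega]
    exact (Nat.modEq_zero_iff_dvd.2 (cyclicity_dvd (hpath.trans hq))).trans
      (Nat.modEq_zero_iff_dvd.2 hγ).symm
  · rintro ⟨s, hs, m, hm, k, hki, hks⟩
    obtain ⟨hk, q, hqm, hq⟩ := (mem_classBefore_iff hconn hi).1 hki
    obtain ⟨N, hN⟩ := exists_forall_hasPath hconn hi hk hq
    have hγpos := cyclicity_pos hconn.1
    refine (mpow_le_kleeneStar_core hvis r hi t).antisymm ?_
    -- Raising the exponent leaves room for the `m + 1` final steps and at least `N` critical steps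
    -- before them.
    rw [← mpow_add_mul_cyclicity hirr hvis hconn hr (N + m + 1)]
    have hlarge : N + m + 1 ≤ r + (N + m + 1) * cyclicity A :=
      (Nat.le_mul_of_pos_right _ hγpos).trans (Nat.le_add_left _ _)
    have hdvd : cyclicity A ∣ r + (N + m + 1) * cyclicity A := hγ.add (dvd_mul_left _ _)
    obtain ⟨p, hp⟩ := Nat.exists_eq_add_of_le' (show m + 1 ≤ r + (N + m + 1) * cyclicity A by omega)
    rw [hp] at hdvd hlarge ⊢
    have hpath : HasPath (critEdge A) p i k := hN p (by omega) <|
      Nat.modEq_zero_iff_dvd.1 <| (hqm.add_left p).trans (Nat.modEq_zero_iff_dvd.2 hdvd)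
    rw [← (mem_W_iff hvis).1 hs, ← ((mem_U_iff hvis).1 hm).2, ← (mem_argmaxCol_iff.1 hks).2,
      show p + (m + 1) = p + 1 + m by ring]
    refine le_trans ?_ (mpow_mul_le A (p + 1) m i s.1 t.1)
    refine mul_le_mul' ?_ (mpow_B_le A m s t)
    refine le_trans ?_ (mul_le_mpow_succ A p i k s.1)
    rw [mpow_eq_one_of_hasPath hvis hpath, one_mul]
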